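/- Let $(X,d)$ be a countable compact metric space. Put $X^{(0)}=X$, let $X^{(\beta+1)}$ be the set of accumulation points of $X^{(\beta)}$, and let $X^{(\lambda)}=\bigcap_{\beta<\lambda}X^{(\beta)}$ for limit ordinals $\lambda$. Suppose that $X$ has derived degree $\alpha$, that is, $X^{(\alpha)}\neq\emptyset$ and $X^{(\alpha+1)}=\emptyset$, where $\alpha>\omega$ (the first infinite ordinal) is not a limit ordinal. Let $n\ge 1$ be an integer. Let $\mathcal H(X)$ be the set of homeomorphisms of $X$ onto itself with the metric $D(T_1,T_2)=\max_{x\in X} d(T_1x,T_2x)$, and let $\mathcal E_n(X)$ be the set of $n$-expansive $T\in\mathcal H(X)$, that is, those for which there is $\delta>0$ such that for every $x\in X$ the set $\{y\in X : d(T^kx,T^ky)\le\delta \text{ for all } k\in\mathbb Z\}$ has at most $n$ elements. Then $\overline{\mathcal E_n(X)}\neq\mathcal H(X)$; that is, the $n$-expansive homeomorphisms are not dense in $\mathcal H(X)$. -/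

import Mathlib

/-- The set `𝓗(X)` of homeomorphisms of a compact metric space `X` onto itself, metrized by
`D(T, S) = sup_x d(T x, S x)`. The supremum is attained, since `X` is compact, when `X` is
nonempty. -/
noncomputable instance homeomorphSupMetric {X : Type*} [MetricSpace X] [CompactSpace X] :
    MetricSpace (X ≃ₜ X) where
  dist T S := ⨆ x, dist (T x) (S x)
  dist_self T := by simp
  dist_comm T S := by simp only [dist_comm]
  dist_triangle T S R := by
    have hb : ∀ F G : X ≃ₜ X, BddAbove (Set.range fun x => dist (F x) (G x)) := fun F G =>
      (isCompact_range (F.continuous.dist G.continuous)).bddAbove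
    have hn : ∀ F G : X ≃ₜ X, 0 ≤ ⨆ x, dist (F x) (G x) := fun F G =>
      Real.iSup_nonneg fun x => dist_nonneg
    refine Real.iSup_le (fun x => ?_) (add_nonneg (hn T S) (hn S R))
    exact (dist_triangle (T x) (S x) (R x)).trans
      (add_le_add (le_ciSup (hb T S) x) (le_ciSup (hb S R) x))
  eq_of_dist_eq_zero := by
    intro T S h
    ext x
    have hb : BddAbove (Set.range fun x => dist (T x) (S x)) :=
      (isCompact_range (T.continuous.dist S.continuous)).bddAbove
    have hx : dist (T x) (S x) ≤ ⨆ x, dist (T x) (S x) := le_ciSup hb x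
    exact dist_le_zero.1 (hx.trans h.le)

/-- The set `Γ_δ[x, T]` of the points whose full orbit under `T` stays within distance `δ` of the
orbit of `x`. -/
def companionSet {X : Type*} [MetricSpace X] (T : X ≃ₜ X) (δ : ℝ) (x : X) : Set X :=
  {y | ∀ k : ℤ, dist ((T ^ k) x) ((T ^ k) y) ≤ δ}

/-- `T` is `n`-expansive: for some `δ > 0` every `Γ_δ[x, T]` has at most `n` elements. -/
def IsNExpansive {X : Type*} [MetricSpace X] (n : ℕ) (T : X ≃ₜ X) : Prop :=
  ∃ δ : ℝ, 0 < δ ∧ ∀ x : X, (companionSet T δ x).encard ≤ n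

/-- The set `𝓔_n(X)` of the `n`-expansive homeomorphisms of `X`. -/
def nExpansiveHomeos (X : Type*) [MetricSpace X] (n : ℕ) : Set (X ≃ₜ X) :=
  {T | IsNExpansive n T}

/-- `d(X) = α`: the derived set of `X` of order `α` is nonempty and that of order `α + 1` is
empty. -/
def HasDerivedDegree (X : Type*) [TopologicalSpace X] (α : Ordinal) : Prop :=
  (CantorBendixson.iteratedDerivedSet (Set.univ : Set X) α).Nonempty ∧
    CantorBendixson.iteratedDerivedSet (Set.univ : Set X) (α + 1) = ∅

/-!
Let `l` be a limit ordinal with `X^(l + 1) ≠ X^(l)`, and let `p` be an isolated point of `X^(l)`.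
As `p` lies outside the perfect kernel, it has a countable neighborhood, so some clopen `U` meets
`X^(l)` in `p` alone. Every homeomorphism `S` close to the identity preserves `U`; it also
preserves each derived set, so it fixes `p`. By compactness the sets `X^(b) ∩ U` shrink to `p` as
`b` increases to `l`. Each of them is infinite and `S`-invariant, and one contained in the
`δ`-ball around `p` consists of points whose orbits stay `δ`-close to `p`. Thus `S` is not
`n`-expansive for any `n`. Derived sets decrease strictly up to the derived degree, so `l = ω`
qualifies once the degree is at least `ω`.
-/

open CantorBendixson Filter Set Topology

universe u

section IteratedDerivedSet

variable {X Y : Type u} [TopologicalSpace X] [TopologicalSpace Y] {s : Set X} {a b : Ordinal.{u}}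

theorem mapsTo_iteratedDerivedSet {f : X → Y} {t : Set Y} (hf : Continuous f)
    (hinj : Function.Injective f) (hst : MapsTo f s t) (a : Ordinal.{u}) :
    MapsTo f sᵈ[a] tᵈ[a] := by
  induction a using Ordinal.limitRecOn with
  | zero => simpa only [iteratedDerivedSet_zero] using hst
  | add_one a ih =>
    simp only [iteratedDerivedSet_succ]
    intro x hx
    have hacc : AccPt (f x) (map f (𝓟 sᵈ[a])) := AccPt.map hx.1 hf.continuousAt hinj
    exact ⟨hacc.mono (tendsto_principal_principal.2 ih), ih hx.2⟩
  | limit a ha ih =>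
    simp only [iteratedDerivedSet_limit ha]
    exact fun x hx => mem_iInter.2 fun b => ih b.1 b.2 (mem_iInter.1 hx b)

theorem accPt_iteratedDerivedSet_of_lt {x : X} (hab : a < b) (hx : x ∈ sᵈ[b]) :
    AccPt x (𝓟 sᵈ[a]) := by
  have hx' : x ∈ sᵈ[a + 1] := iteratedDerivedSet_antitone s (Order.add_one_le_of_lt hab) hx
  rw [iteratedDerivedSet_succ] at hx'
  exact hx'.1

theorem iteratedDerivedSet_eq_of_succ_eq (h : sᵈ[a + 1] = sᵈ[a]) (hab : a ≤ b) :
    sᵈ[b] = sᵈ[a] := by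
  refine (iteratedDerivedSet_antitone s hab).antisymm ?_
  rw [← perfectKernel_eq_iteratedDerivedSet_of_mem_fixedPoints
    (mem_fixedPoints_of_iteratedDerivedSet_succ_eq h)]
  exact perfectKernel_subset_iteratedDerivedSet s b

theorem exists_lt_iteratedDerivedSet_inter_subset (hs : IsClosed s) (ha : Order.IsSuccLimit a)
    {K O : Set X} (hK : IsCompact K) (hO : IsOpen O) (hsub : sᵈ[a] ∩ K ⊆ O) :
    ∃ b < a, sᵈ[b] ∩ K ⊆ O := by
  have : Nonempty (Iio a) := ⟨⟨0, ha.bot_lt⟩⟩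
  have hempty : (K \ O) ∩ ⋂ b : Iio a, sᵈ[b] = ∅ := by
    rw [← iteratedDerivedSet_limit ha]
    exact eq_empty_of_forall_notMem fun x hx => hx.1.2 (hsub ⟨hx.2, hx.1.1⟩)
  obtain ⟨⟨b, hb⟩, hbO⟩ := (hK.diff hO).elim_directed_family_closed (fun b : Iio a => sᵈ[b])
    (fun b => isClosed_iteratedDerivedSet hs b) hempty
    (directed_of_isDirected_le fun b c hbc => iteratedDerivedSet_antitone s hbc)
  refine ⟨b, hb, fun x hx => ?_⟩
  by_contra hxO
  exact (hbO ▸ ⟨⟨hx.2, hxO⟩, hx.1⟩ : x ∈ (∅ : Set X))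

theorem countable_diff_perfectKernel [SecondCountableTopology X] (hs : IsClosed s) :
    (s \ perfectKernel s).Countable := by
  obtain ⟨V, D, hV, hD, rfl⟩ := exists_countable_union_perfect_of_isClosed hs
  refine hV.mono fun x hx => hx.1.resolve_right fun hxD => hx.2 ?_
  exact hD.subset_perfectKernel subset_union_right hxD

theorem HasDerivedDegree.iteratedDerivedSet_succ_ne (hX : HasDerivedDegree X b) (hab : a ≤ b) :
    (univ : Set X)ᵈ[a + 1] ≠ (univ : Set X)ᵈ[a] := by
  intro h
  have hb : (univ : Set X)ᵈ[b + 1] = (univ : Set X)ᵈ[b] :=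
    (iteratedDerivedSet_eq_of_succ_eq h (hab.trans (le_add_of_nonneg_right zero_le_one))).trans
      (iteratedDerivedSet_eq_of_succ_eq h hab).symm
  exact hX.1.ne_empty (hb ▸ hX.2)

end IteratedDerivedSet

section IsClopen

theorem exists_isClopen_subset_of_countable_of_mem_nhds {X : Type*} [PseudoMetricSpace X]
    {C : Set X} {p : X} (hC : C.Countable) (hCp : C ∈ 𝓝 p) :
    ∃ U, IsClopen U ∧ p ∈ U ∧ U ⊆ C := by
  obtain ⟨R, hR, hRC⟩ := Metric.mem_nhds_iff.1 hCp
  -- Only countably many radii are distances from `p` to a point of `C`; avoid them all.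
  obtain ⟨r, hr, hr0, hrR⟩ := ((hC.image (dist · p)).dense_compl ℝ).exists_between hR
  have hball : Metric.closedBall p r = Metric.ball p r := by
    refine Subset.antisymm (fun y hy => ?_) Metric.ball_subset_closedBall
    have hyC : y ∈ C := hRC (Metric.closedBall_subset_ball hrR hy)
    exact Metric.mem_ball.2 (lt_of_le_of_ne hy fun hyr => hr ⟨y, hyC, hyr⟩)
  exact ⟨Metric.ball p r, ⟨hball ▸ Metric.isClosed_closedBall, Metric.isOpen_ball⟩,
    Metric.mem_ball_self hr0, (Metric.ball_subset_ball hrR.le).trans hRC⟩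

theorem exists_isClopen_iteratedDerivedSet_inter_eq_singleton {X : Type u} [PseudoMetricSpace X]
    [SecondCountableTopology X] {a : Ordinal.{u}} {p : X} (hp : p ∈ (univ : Set X)ᵈ[a])
    (hp' : p ∉ (univ : Set X)ᵈ[a + 1]) :
    ∃ U, IsClopen U ∧ (univ : Set X)ᵈ[a] ∩ U = {p} := by
  have hiso : ∃ V ∈ 𝓝 p, ∀ y ∈ V ∩ (univ : Set X)ᵈ[a], y = p := by
    rw [iteratedDerivedSet_succ] at hp'
    simpa [accPt_iff_nhds] using fun hacc => hp' ⟨hacc, hp⟩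
  obtain ⟨V, hV, hVp⟩ := hiso
  have hker : (perfectKernel (univ : Set X))ᶜ ∈ 𝓝 p :=
    (isClosed_perfectKernel isClosed_univ).isOpen_compl.mem_nhds fun h =>
      hp' (perfectKernel_subset_iteratedDerivedSet univ (a + 1) h)
  have hcount : (perfectKernel (univ : Set X))ᶜ.Countable :=
    compl_eq_univ_sdiff (perfectKernel (univ : Set X)) ▸ countable_diff_perfectKernel isClosed_univ
  obtain ⟨U, hU, hpU, hUV⟩ := exists_isClopen_subset_of_countable_of_mem_nhds
    (hcount.mono inter_subset_right) (inter_mem hV hker)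
  exact ⟨U, hU, Subset.antisymm (fun y hy => hVp y ⟨(hUV hy.2).1, hy.1⟩)
    (singleton_subset_iff.2 ⟨hp, hpU⟩)⟩

end IsClopen

section Homeomorph

theorem dist_apply_le_dist {X : Type*} [MetricSpace X] [CompactSpace X] (T S : X ≃ₜ X) (x : X) :
    dist (T x) (S x) ≤ dist T S :=
  le_ciSup (isCompact_range (T.continuous.dist S.continuous)).bddAbove x

theorem eventually_preimage_eq_of_isClopen {X : Type*} [MetricSpace X] [CompactSpace X] {U : Set X}
    (hU : IsClopen U) (T : X ≃ₜ X) : ∀ᶠ S : X ≃ₜ X in 𝓝 T, S ⁻¹' U = T ⁻¹' U := by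
  obtain ⟨ε, hε, hεU⟩ :=
    hU.isClosed.isCompact.exists_thickening_subset_open hU.isOpen Subset.rfl
  have mem_of_dist_lt {y z : X} (hyz : dist y z < ε) (hz : z ∈ U) : y ∈ U :=
    hεU (Metric.mem_thickening_iff.2 ⟨z, hz, hyz⟩)
  filter_upwards [Metric.ball_mem_nhds T hε] with S hS
  ext x
  have hx : dist (S x) (T x) < ε := (dist_apply_le_dist S T x).trans_lt hS
  exact ⟨mem_of_dist_lt (dist_comm (T x) (S x) ▸ hx), mem_of_dist_lt hx⟩

theorem preimage_zpow_eq {X : Type*} [TopologicalSpace X] {S : X ≃ₜ X} {U : Set X}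
    (hU : S ⁻¹' U = U) (k : ℤ) : ⇑(S ^ k) ⁻¹' U = U := by
  have hinv : ⇑S⁻¹ ⁻¹' U = U := by
    conv_lhs => rw [← hU]
    ext x
    simp
  induction k with
  | zero => rfl
  | succ k ih =>
    rw [zpow_add_one]
    exact (congrArg (S ⁻¹' ·) ih).trans hU
  | pred k ih =>
    rw [zpow_sub_one]
    exact (congrArg (⇑S⁻¹ ⁻¹' ·) ih).trans hinv

end Homeomorph

section NExpansive

variable {X : Type u} [MetricSpace X] {l : Ordinal.{u}} {U : Set X} {p : X} {S : X ≃ₜ X}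

theorem infinite_companionSet (hl : Order.IsSuccLimit l) (hUc : IsCompact U) (hUo : IsOpen U)
    (hp : (univ : Set X)ᵈ[l] ∩ U = {p}) (hS : S ⁻¹' U = U) {δ : ℝ} (hδ : 0 < δ) :
    (companionSet S δ p).Infinite := by
  obtain ⟨hpl, hpU⟩ : p ∈ (univ : Set X)ᵈ[l] ∩ U := hp ▸ mem_singleton p
  have mapsTo_zpow (k : ℤ) (a : Ordinal.{u}) :
      MapsTo (S ^ k) ((univ : Set X)ᵈ[a] ∩ U) ((univ : Set X)ᵈ[a] ∩ U) :=
    (mapsTo_iteratedDerivedSet (S ^ k).continuous (S ^ k).injective (mapsTo_univ _ _) a).inter_inter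
      (preimage_zpow_eq hS k).ge
  have hfix (k : ℤ) : (S ^ k) p = p := by
    simpa only [hp, mem_singleton_iff] using mapsTo_zpow k l ⟨hpl, hpU⟩
  obtain ⟨b, hb, hbδ⟩ : ∃ b < l, (univ : Set X)ᵈ[b] ∩ U ⊆ Metric.ball p δ :=
    exists_lt_iteratedDerivedSet_inter_subset isClosed_univ hl hUc Metric.isOpen_ball
      (hp ▸ singleton_subset_iff.2 (Metric.mem_ball_self hδ))
  have hinf : (U ∩ (univ : Set X)ᵈ[b]).Infinite :=
    Infinite.of_accPt ((accPt_iteratedDerivedSet_of_lt hb hpl).nhds_inter (hUo.mem_nhds hpU))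
  refine hinf.mono fun y hy k => ?_
  rw [hfix, dist_comm]
  exact (hbδ (mapsTo_zpow k b hy.symm)).le

theorem not_isNExpansive_of_preimage_eq (hl : Order.IsSuccLimit l) (hUc : IsCompact U)
    (hUo : IsOpen U) (hp : (univ : Set X)ᵈ[l] ∩ U = {p}) (hS : S ⁻¹' U = U) (n : ℕ) :
    ¬ IsNExpansive n S := by
  rintro ⟨δ, hδ, hcard⟩
  exact infinite_companionSet hl hUc hUo hp hS hδ
    (finite_of_encard_le_coe (hcard p))

theorem mainTheorem11_general [CompactSpace X] (hl : Order.IsSuccLimit l)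
    (h : (univ : Set X)ᵈ[l + 1] ≠ (univ : Set X)ᵈ[l]) :
    (1 : X ≃ₜ X) ∉ closure (⋃ n, nExpansiveHomeos X n) := by
  obtain ⟨p, hp, hp'⟩ := exists_of_ssubset
    ((iteratedDerivedSet_antitone univ (le_add_of_nonneg_right zero_le_one)).ssubset_of_ne h)
  obtain ⟨U, hU, hUp⟩ := exists_isClopen_iteratedDerivedSet_inter_eq_singleton hp hp'
  rw [mem_closure_iff_frequently, not_frequently]
  filter_upwards [eventually_preimage_eq_of_isClopen hU 1] with S hS
  exact mt mem_iUnion.1 <| not_exists.2 <|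
    not_isNExpansive_of_preimage_eq hl hU.isClosed.isCompact hU.isOpen hUp hS

end NExpansive

theorem mainTheorem11 {X : Type*} [MetricSpace X] [CompactSpace X] [Countable X]
    (α : Ordinal) (hX : HasDerivedDegree X α) (hlim : ¬ Order.IsSuccLimit α)
    (hα : Ordinal.omega0 < α) (n : ℕ) (hn : 1 ≤ n) :
    closure (nExpansiveHomeos X n) ≠ (Set.univ : Set (X ≃ₜ X)) := fun h =>
  mainTheorem11_general Ordinal.isSuccLimit_omega0 (hX.iteratedDerivedSet_succ_ne hα.le)
    (closure_mono (subset_iUnion (nExpansiveHomeos X) n) (h ▸ mem_univ 1))
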